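/- Let $a_n>0$ and $b_n\in\mathbb R$, $n=0,1,2,\dots$, be sequences such that $$\lim_{n\to\infty}a_n=\tfrac12,\qquad \lim_{n\to\infty}b_n=0,\qquad \sum_{n=0}^\infty\big(|a_{n+1}-a_n|+|b_{n+1}-b_n|\big)<\infty .$$ Let $J$ be the Jacobi operator with these coefficients, that is, the bounded self-adjoint operator on the complex Hilbert space $\ell^2(\mathbb Z_+)$, $\mathbb Z_+=\{0,1,2,\dots\}$, given by $$(Ju)_0=b_0u_0+a_0u_1,\qquad (Ju)_n=a_{n-1}u_{n-1}+b_nu_n+a_nu_{n+1}\quad(n\ge1),$$ and let $E(\cdot)$ be its spectral measure (resolution of the identity). Then the spectrum of $J$ on the interval $(-1,1)$ is (purely) absolutely continuous: for every $f\in\ell^2(\mathbb Z_+)$, the restriction to $(-1,1)$ of the Borel measure $B\mapsto\langle E(B)f,f\rangle$ is absolutely continuous with respect to Lebesgue measure. -/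

import Mathlib

open Filter Topology MeasureTheory
open scoped InnerProductSpace

/-- The complex Hilbert space `ℓ²(ℤ₊)`, where `ℤ₊ = {0, 1, 2, …}`. -/
abbrev EllTwo : Type := lp (fun _ : ℕ => ℂ) 2

/-- The vector `u` shifted by one to the right, with `0` in front: `(0, u₀, u₁, …)`. -/
def shiftRight (u : ℕ → ℂ) : ℕ → ℂ
  | 0 => 0
  | n + 1 => u n

/-- The action of the Jacobi matrix with diagonal `b` and off-diagonal `a` on sequences:
`(J u)₀ = b₀ u₀ + a₀ u₁` and `(J u)ₙ = aₙ₋₁ uₙ₋₁ + bₙ uₙ + aₙ uₙ₊₁` for `n ≥ 1`. -/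
def jacobiAction (a b : ℕ → ℝ) (u : ℕ → ℂ) (n : ℕ) : ℂ :=
  shiftRight (fun k => (a k : ℂ) * u k) n + (b n : ℂ) * u n + (a n : ℂ) * u (n + 1)

theorem jacobiAction_zero (a b : ℕ → ℝ) (u : ℕ → ℂ) :
    jacobiAction a b u 0 = (b 0 : ℂ) * u 0 + (a 0 : ℂ) * u 1 := by
  simp [jacobiAction, shiftRight]

theorem jacobiAction_succ (a b : ℕ → ℝ) (u : ℕ → ℂ) (n : ℕ) :
    jacobiAction a b u (n + 1)
      = (a n : ℂ) * u n + (b (n + 1) : ℂ) * u (n + 1) + (a (n + 1) : ℂ) * u (n + 2) := by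
  simp [jacobiAction, shiftRight]

theorem memlp_two_iff (u : ℕ → ℂ) : Memℓp u 2 ↔ Summable fun n => ‖u n‖ ^ 2 := by
  rw [memℓp_gen_iff (by simp)]
  simp

theorem memlp_mul_of_bounded {c : ℕ → ℝ} (hc : BddAbove (Set.range fun n => |c n|))
    {u : ℕ → ℂ} (hu : Memℓp u 2) : Memℓp (fun n => (c n : ℂ) * u n) 2 := by
  obtain ⟨M, hM⟩ := hc
  rw [memlp_two_iff] at hu ⊢
  refine Summable.of_nonneg_of_le (fun n => by positivity) (fun n => ?_) (hu.mul_left (M ^ 2))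
  have h : |c n| ≤ M := hM ⟨n, rfl⟩
  rw [norm_mul, mul_pow, Complex.norm_real, Real.norm_eq_abs]
  gcongr

theorem memlp_shiftRight {u : ℕ → ℂ} (hu : Memℓp u 2) : Memℓp (shiftRight u) 2 := by
  rw [memlp_two_iff] at hu ⊢
  rw [← summable_nat_add_iff 1]
  exact hu

theorem memlp_shiftLeft {u : ℕ → ℂ} (hu : Memℓp u 2) : Memℓp (fun n => u (n + 1)) 2 := by
  rw [memlp_two_iff] at hu ⊢
  exact (summable_nat_add_iff (f := fun n => ‖u n‖ ^ 2) 1).2 hu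

theorem memlp_jacobiAction {a b : ℕ → ℝ} (ha : BddAbove (Set.range fun n => |a n|))
    (hb : BddAbove (Set.range fun n => |b n|)) {u : ℕ → ℂ} (hu : Memℓp u 2) :
    Memℓp (jacobiAction a b u) 2 :=
  ((memlp_shiftRight (memlp_mul_of_bounded ha hu)).add (memlp_mul_of_bounded hb hu)).add
    (memlp_mul_of_bounded ha (memlp_shiftLeft hu))

/-- The Jacobi matrix with bounded coefficients as a linear map on `ℓ²(ℤ₊)`. -/
def jacobiLinearMap (a b : ℕ → ℝ) (ha : BddAbove (Set.range fun n => |a n|))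
    (hb : BddAbove (Set.range fun n => |b n|)) : EllTwo →ₗ[ℂ] EllTwo where
  toFun u := ⟨jacobiAction a b u, memlp_jacobiAction ha hb (lp.memℓp u)⟩
  map_add' u v := Subtype.ext <| funext fun n => by
    change jacobiAction a b (fun k => u k + v k) n = jacobiAction a b u n + jacobiAction a b v n
    cases n <;> simp [jacobiAction, shiftRight] <;> ring
  map_smul' c u := Subtype.ext <| funext fun n => by
    change jacobiAction a b (fun k => c * u k) n = c * jacobiAction a b u n
    cases n <;> simp [jacobiAction, shiftRight] <;> ring

theorem inner_shift_eq (a : ℕ → ℝ) (x y A B : EllTwo)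
    (hA : ∀ n, A n = shiftRight (fun k => (a k : ℂ) * x k) n)
    (hB : ∀ n, B n = (a n : ℂ) * y (n + 1)) : ⟪A, y⟫_ℂ = ⟪x, B⟫_ℂ := by
  have h : ∑' n, ⟪A n, y n⟫_ℂ = ⟪A 0, y 0⟫_ℂ + ∑' n, ⟪A (n + 1), y (n + 1)⟫_ℂ :=
    Summable.tsum_eq_zero_add (f := fun n => ⟪A n, y n⟫_ℂ) (lp.summable_inner A y)
  rw [lp.inner_eq_tsum, lp.inner_eq_tsum, h, hA 0]
  simp only [shiftRight, inner_zero_left, zero_add]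
  refine tsum_congr fun n => ?_
  rw [hA (n + 1), hB n]
  simp only [shiftRight, RCLike.inner_apply, map_mul, Complex.conj_ofReal]
  ring

theorem isSymmetric_jacobiLinearMap (a b : ℕ → ℝ) (ha : BddAbove (Set.range fun n => |a n|))
    (hb : BddAbove (Set.range fun n => |b n|)) : (jacobiLinearMap a b ha hb).IsSymmetric := by
  intro u v
  let R : EllTwo → EllTwo := fun w =>
    ⟨_, memlp_shiftRight (memlp_mul_of_bounded ha (lp.memℓp w))⟩
  let D : EllTwo → EllTwo := fun w => ⟨_, memlp_mul_of_bounded hb (lp.memℓp w)⟩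
  let L : EllTwo → EllTwo := fun w =>
    ⟨_, memlp_mul_of_bounded ha (memlp_shiftLeft (lp.memℓp w))⟩
  have hJ : ∀ w, jacobiLinearMap a b ha hb w = R w + D w + L w := fun w => rfl
  have hRL : ∀ x y : EllTwo, ⟪R x, y⟫_ℂ = ⟪x, L y⟫_ℂ := fun x y =>
    inner_shift_eq a x y (R x) (L y) (fun _ => rfl) (fun _ => rfl)
  have hLR : ∀ x y : EllTwo, ⟪L x, y⟫_ℂ = ⟪x, R y⟫_ℂ := by
    intro x y
    rw [← inner_conj_symm, ← hRL, inner_conj_symm]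
  have hD : ⟪D u, v⟫_ℂ = ⟪u, D v⟫_ℂ := by
    rw [lp.inner_eq_tsum, lp.inner_eq_tsum]
    refine tsum_congr fun n => ?_
    change ⟪(b n : ℂ) * u n, v n⟫_ℂ = ⟪u n, (b n : ℂ) * v n⟫_ℂ
    simp only [RCLike.inner_apply, map_mul, Complex.conj_ofReal]
    ring
  rw [hJ, hJ]
  simp only [inner_add_left, inner_add_right, hRL, hLR, hD]
  ring

/-- The Jacobi operator `J` with bounded coefficients, as a bounded operator on `ℓ²(ℤ₊)`. -/
noncomputable def jacobiOperator (a b : ℕ → ℝ) (ha : BddAbove (Set.range fun n => |a n|))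
    (hb : BddAbove (Set.range fun n => |b n|)) : EllTwo →L[ℂ] EllTwo :=
  ⟨jacobiLinearMap a b ha hb, (isSymmetric_jacobiLinearMap a b ha hb).continuous⟩

theorem jacobiOperator_apply (a b : ℕ → ℝ) (ha : BddAbove (Set.range fun n => |a n|))
    (hb : BddAbove (Set.range fun n => |b n|)) (u : EllTwo) (n : ℕ) :
    jacobiOperator a b ha hb u n = jacobiAction a b u n := rfl

theorem isSelfAdjoint_jacobiOperator (a b : ℕ → ℝ)
    (ha : BddAbove (Set.range fun n => |a n|)) (hb : BddAbove (Set.range fun n => |b n|)) :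
    IsSelfAdjoint (jacobiOperator a b ha hb) :=
  ContinuousLinearMap.isSelfAdjoint_iff_isSymmetric.2 (isSymmetric_jacobiLinearMap a b ha hb)

section SpectralMeasure

variable {H : Type*} [NormedAddCommGroup H] [InnerProductSpace ℂ H] [CompleteSpace H]

/-- The positive linear functional `g ↦ ⟪f, g(T) f⟫` on the compactly supported continuous
functions on `ℝ`, where `g(T)` is given by the continuous functional calculus of the bounded
self-adjoint operator `T`. -/
noncomputable def spectralFunctional (T : H →L[ℂ] H) (f : H) :
    CompactlySupportedContinuousMap ℝ ℝ →ₚ[ℝ] ℝ :=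
  PositiveLinearMap.mk₀
    { toFun := fun g => (⟪f, cfc (fun x => g x) T f⟫_ℂ).re
      map_add' := fun g h => by
        have e := cfc_add (a := T) (fun x => g x) (fun x => h x)
          g.continuous.continuousOn h.continuous.continuousOn
        simp only [CompactlySupportedContinuousMap.add_apply, e, _root_.add_apply,
          inner_add_right, Complex.add_re]
      map_smul' := fun c g => by
        have e := cfc_smul c (fun x => g x) T g.continuous.continuousOn
        simp only [CompactlySupportedContinuousMap.smul_apply, e, _root_.smul_apply,
          RingHom.id_apply]
        rw [← Complex.coe_smul, inner_smul_right, Complex.re_ofReal_mul, smul_eq_mul] }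
    (fun g hg => by
      have h : 0 ≤ cfc (fun x => g x) T := cfc_nonneg fun x _ => hg x
      exact ((ContinuousLinearMap.nonneg_iff_isPositive _).1 h).re_inner_nonneg_right f)

/-- The spectral measure `B ↦ ⟪f, E(B) f⟫` of a bounded self-adjoint operator `T` at the vector
`f`, where `E` is the spectral family of `T`: the Borel measure `μ` on `ℝ` with
`∫ g dμ = ⟪f, g(T) f⟫` for all compactly supported continuous functions `g`. -/
noncomputable def spectralMeasure (T : H →L[ℂ] H) (f : H) : Measure ℝ :=
  RealRMK.rieszMeasure (spectralFunctional T f)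

/-- The defining property of the spectral measure. -/
theorem integral_spectralMeasure (T : H →L[ℂ] H) (f : H)
    (g : CompactlySupportedContinuousMap ℝ ℝ) :
    ∫ x, g x ∂(spectralMeasure T f) = (⟪f, cfc (fun x => g x) T f⟫_ℂ).re :=
  RealRMK.integral_rieszMeasure (spectralFunctional T f) g

/-- The spectrum of the bounded self-adjoint operator `T` on the Borel set `Δ ⊆ ℝ` is (purely)
absolutely continuous: for every vector `f`, the restriction to `Δ` of the measure
`B ↦ ⟪f, E(B) f⟫` is absolutely continuous with respect to Lebesgue measure. -/
def HasAbsolutelyContinuousSpectrumOn (T : H →L[ℂ] H) (Δ : Set ℝ) : Prop :=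
  ∀ f : H, (spectralMeasure T f).restrict Δ ≪ volume

end SpectralMeasure

/-! ### Spectral measures: size, dependence on the vector, and control by the resolvent. -/

section SpectralBounds

variable {H : Type*} [NormedAddCommGroup H] [InnerProductSpace ℂ H] [CompleteSpace H]

/-! Let `u = (J - x - iε)⁻¹ δ_k` with `|x| < 1`. Past site `k` it solves the homogeneous recurrence,
and `jacobiEnergy` is, far out, a positive definite form in its Cauchy data precisely because `|x| <
1`. One step lowers the energy by a relative amount `O(|Δa| + |Δb| + ε)`, so bounded variation keeps
the data comparable to that at `k` over about `1/ε` sites (`exists_cauchyNormSq_lower_bound`).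
Summing gives `|u_k|² ≤ C ε‖u‖²`. But `ε‖u‖² = Im u_k ≤ |u_k|`, so `|u_k|`, and with it `ε‖u‖²`, is
bounded as `ε → 0` (`exists_resolvent_bound`). Since `ε‖u‖²` is the Poisson integral of the spectral
measure of `δ_k`, that measure gives `[x-ε, x+ε]` mass `O(ε)` (`spectralMeasure_closedBall_le`);
differentiation of measures then yields absolute continuity. The vectors whose spectral measure
kills a given set form a closed subspace, so the `δ_k` suffice. -/

theorem re_inner_cfc_mono (T : H →L[ℂ] H) (f : H) {g h : ℝ → ℝ} (hg : Continuous g)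
    (hh : Continuous h) (hgh : ∀ y, g y ≤ h y) :
    (⟪f, cfc g T f⟫_ℂ).re ≤ (⟪f, cfc h T f⟫_ℂ).re := by
  have h1 : cfc g T ≤ cfc h T :=
    cfc_mono (fun y _ => hgh y) hg.continuousOn hh.continuousOn
  have h2 := ((ContinuousLinearMap.le_def _ _).1 h1).re_inner_nonneg_right f
  simp only [_root_.sub_apply, inner_sub_right, map_sub, RCLike.re_to_complex] at h2
  linarith

theorem spectralMeasure_le_of_eq_one (T : H →L[ℂ] H) (f : H)
    (g : CompactlySupportedContinuousMap ℝ ℝ) (hg : ∀ y, 0 ≤ g y) {K : Set ℝ} (hK : IsCompact K)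
    (hgK : ∀ y ∈ K, g y = 1) :
    spectralMeasure T f K ≤ ENNReal.ofReal (⟪f, cfc (fun y => g y) T f⟫_ℂ).re :=
  RealRMK.rieszMeasure_le_of_eq_one (spectralFunctional T f) hg hK hgK

theorem spectralMeasure_univ_le {T : H →L[ℂ] H} (hT : IsSelfAdjoint T) (f : H) :
    spectralMeasure T f Set.univ ≤ ENNReal.ofReal (‖f‖ ^ 2) := by
  have hreg : (spectralMeasure T f).Regular := RealRMK.regular_rieszMeasure _
  rw [isOpen_univ.measure_eq_iSup_isCompact]
  refine iSup_le fun K => iSup_le fun _ => iSup_le fun hK => ?_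
  obtain ⟨g, hgK, -, hgc, hg⟩ := exists_continuous_one_zero_of_isCompact hK isClosed_empty
    (Set.disjoint_empty K)
  refine (spectralMeasure_le_of_eq_one T f ⟨g, hgc⟩ (fun y => (hg y).1) hK hgK).trans ?_
  refine ENNReal.ofReal_le_ofReal ?_
  refine (re_inner_cfc_mono T f g.continuous continuous_const (fun y => (hg y).2)).trans ?_
  rw [cfc_const_one ℝ T]
  simp [inner_self_eq_norm_sq_to_K, ← Complex.ofReal_pow]

theorem isFiniteMeasure_spectralMeasure {T : H →L[ℂ] H} (hT : IsSelfAdjoint T) (f : H) :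
    IsFiniteMeasure (spectralMeasure T f) :=
  ⟨(spectralMeasure_univ_le hT f).trans_lt ENNReal.ofReal_lt_top⟩

/-- Each `f ↦ ⟪f, φ(T) f⟫` is a quadratic form, and such integrals determine a finite measure. This
gives linear structure in `f` without constructing the projections `E(B)`. -/
theorem spectralMeasure_parallelogram {T : H →L[ℂ] H} (hT : IsSelfAdjoint T) (f g : H) :
    spectralMeasure T (f + g) + spectralMeasure T (f - g)
      = (2 : NNReal) • (spectralMeasure T f + spectralMeasure T g) := by
  have hreg : ∀ h, (spectralMeasure T h).Regular := fun h => RealRMK.regular_rieszMeasure _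
  have hfin := isFiniteMeasure_spectralMeasure hT
  have hint : ∀ (h : H) (φ : CompactlySupportedContinuousMap ℝ ℝ),
      Integrable φ (spectralMeasure T h) := fun h φ =>
    φ.continuous.integrable_of_hasCompactSupport φ.hasCompactSupport
  refine Measure.ext_of_integral_eq_on_compactlySupported fun φ => ?_
  rw [integral_add_measure (hint _ _) (hint _ _), integral_smul_nnreal_measure,
    integral_add_measure (hint _ _) (hint _ _)]
  simp only [integral_spectralMeasure, map_add, map_sub, inner_add_left, inner_add_right,
    inner_sub_left, inner_sub_right, Complex.add_re, Complex.sub_re, NNReal.smul_def, smul_eq_mul,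
    NNReal.coe_ofNat]
  ring

theorem spectralMeasure_add_le {T : H →L[ℂ] H} (hT : IsSelfAdjoint T) (f g : H) (s : Set ℝ) :
    spectralMeasure T (f + g) s ≤ 2 * (spectralMeasure T f s + spectralMeasure T g s) := by
  have h := congrArg (fun μ : Measure ℝ => μ s) (spectralMeasure_parallelogram hT f g)
  simp only [Measure.add_apply, Measure.smul_apply] at h
  refine le_self_add.trans (h.le.trans (le_of_eq ?_))
  simp [ENNReal.smul_def, mul_add]

theorem spectralMeasure_smul {T : H →L[ℂ] H} (hT : IsSelfAdjoint T) (c : ℂ) (f : H) :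
    spectralMeasure T (c • f) = (‖c‖₊ ^ 2) • spectralMeasure T f := by
  have hreg : ∀ h, (spectralMeasure T h).Regular := fun h => RealRMK.regular_rieszMeasure _
  have hfin := isFiniteMeasure_spectralMeasure hT
  refine Measure.ext_of_integral_eq_on_compactlySupported fun φ => ?_
  rw [integral_smul_nnreal_measure]
  simp only [integral_spectralMeasure, map_smul, inner_smul_left, inner_smul_right,
    NNReal.smul_def, smul_eq_mul, NNReal.coe_pow, coe_nnnorm]
  rw [← mul_assoc, Complex.mul_conj, Complex.re_ofReal_mul, Complex.normSq_eq_norm_sq]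

/-- The vectors whose spectral measure vanishes on a given set form a submodule. -/
def spectralNullSubmodule {T : H →L[ℂ] H} (hT : IsSelfAdjoint T) (s : Set ℝ) :
    Submodule ℂ H where
  carrier := {f | spectralMeasure T f s = 0}
  zero_mem' := by
    have h := (measure_mono (Set.subset_univ s)).trans (spectralMeasure_univ_le hT (0 : H))
    simpa using h
  add_mem' {f g} hf hg := by
    have h := spectralMeasure_add_le hT f g s
    rw [Set.mem_ofPred_eq] at hf hg
    simpa [hf, hg] using h
  smul_mem' c f hf := by
    rw [Set.mem_ofPred_eq] at hf ⊢
    simp [spectralMeasure_smul hT, hf]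

theorem mem_spectralNullSubmodule {T : H →L[ℂ] H} (hT : IsSelfAdjoint T) {s : Set ℝ} {f : H} :
    f ∈ spectralNullSubmodule hT s ↔ spectralMeasure T f s = 0 := Iff.rfl

theorem isClosed_spectralNullSubmodule {T : H →L[ℂ] H} (hT : IsSelfAdjoint T) (s : Set ℝ) :
    IsClosed (spectralNullSubmodule hT s : Set H) := by
  refine isClosed_of_closure_subset fun f hf => ?_
  refine le_antisymm (ENNReal.le_of_forall_pos_le_add fun ε hε _ => ?_) zero_le
  -- Chosen so that `2‖f - g‖² ≤ ε`; the 2 comes from `spectralMeasure_add_le`.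
  obtain ⟨g, hg, hfg⟩ := Metric.mem_closure_iff.1 hf (√((ε : ℝ) / 2)) (by positivity)
  have h := spectralMeasure_add_le hT g (f - g) s
  rw [(mem_spectralNullSubmodule hT).1 hg, zero_add, add_sub_cancel] at h
  rw [zero_add]
  refine h.trans ?_
  have h1 : spectralMeasure T (f - g) s ≤ ENNReal.ofReal (ε / 2) := by
    refine ((measure_mono (Set.subset_univ s)).trans (spectralMeasure_univ_le hT _)).trans
      (ENNReal.ofReal_le_ofReal ?_)
    rw [dist_eq_norm] at hfg
    exact (Real.le_sqrt (norm_nonneg _) (by positivity)).1 hfg.le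
  calc 2 * spectralMeasure T (f - g) s ≤ ENNReal.ofReal 2 * ENNReal.ofReal (ε / 2) := by
        rw [ENNReal.ofReal_ofNat]; gcongr
    _ = ε := by
        rw [← ENNReal.ofReal_mul (by norm_num), mul_div_cancel₀ _ (by norm_num : (2 : ℝ) ≠ 0)]
        simp

/-- With `A = T - x`, `f = (A - iε)u`, and `(A + iε) g(T) (A - iε) = g(T)(A² + ε²)` because `A` is
self-adjoint and commutes with `g(T)`. -/
theorem inner_resolvent_sandwich {T : H →L[ℂ] H} (hT : IsSelfAdjoint T) (x ε : ℝ) {g : ℝ → ℝ}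
    (hg : Continuous g) {u f : H} (hu : T u - ((x : ℂ) + ε * Complex.I) • u = f) :
    ⟪f, cfc g T f⟫_ℂ = ⟪u, cfc (fun y => g y * ((y - x) ^ 2 + ε ^ 2)) T u⟫_ℂ := by
  set R := cfc g T with hR
  set A := cfc (fun y : ℝ => y - x) T with hA
  have hAu : A u = T u - (x : ℂ) • u := by
    rw [hA, cfc_sub (fun y : ℝ => y) (fun _ => x) T, cfc_id' ℝ T, cfc_const x T]
    simp [Algebra.algebraMap_eq_smul_one]
  have hcomm : A * R = R * A := cfc_commute_cfc _ _ T
  have hAsa : IsSelfAdjoint A := cfc_predicate _ T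
  have hsym : ∀ v w, ⟪A v, w⟫_ℂ = ⟪v, A w⟫_ℂ :=
    ContinuousLinearMap.isSelfAdjoint_iff_isSymmetric.1 hAsa
  have hf : f = A u - ((ε : ℂ) * Complex.I) • u := by
    rw [← hu, hAu, add_smul]; abel
  have hprod : cfc (fun y => g y * ((y - x) ^ 2 + ε ^ 2)) T = R * (A * A) + (ε ^ 2) • R := by
    have : (fun y => g y * ((y - x) ^ 2 + ε ^ 2))
        = fun y => g y * ((y - x) * (y - x)) + ε ^ 2 • g y := by
      ext y; simp; ring
    rw [this, cfc_add (a := T) (fun y => g y * ((y - x) * (y - x))) (fun y => ε ^ 2 • g y)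
      (by fun_prop) (by fun_prop), cfc_smul (ε ^ 2) g T (by fun_prop),
      cfc_mul g (fun y => (y - x) * (y - x)) T (by fun_prop) (by fun_prop),
      cfc_mul (fun y => y - x) (fun y => y - x) T (by fun_prop) (by fun_prop)]
  have hc : ∀ v, A (R v) = R (A v) := fun v => congrArg (fun S : H →L[ℂ] H => S v) hcomm
  have e1 : ⟪u, ((ε ^ 2 : ℝ) • R) u⟫_ℂ = ((ε : ℂ) ^ 2) * ⟪u, R u⟫_ℂ := by
    rw [_root_.smul_apply, ← Complex.coe_smul, inner_smul_right]
    push_cast; rfl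
  rw [hprod, hf, _root_.add_apply, inner_add_right, e1]
  simp only [map_sub, map_smul, inner_sub_left, inner_sub_right, inner_smul_left,
    inner_smul_right, hsym, hc, map_mul, Complex.conj_ofReal, Complex.conj_I,
    _root_.mul_apply_eq_comp]
  linear_combination (-(ε : ℂ) ^ 2 * ⟪u, R u⟫_ℂ) * Complex.I_sq

theorem exists_resolvent_preimage {T : H →L[ℂ] H} (hT : IsSelfAdjoint T) (x : ℝ) {ε : ℝ}
    (hε : 0 < ε) (f : H) : ∃ u, T u - ((x : ℂ) + ε * Complex.I) • u = f := by
  set z : ℂ := (x : ℂ) + ε * Complex.I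
  have hz : z ∉ spectrum ℂ T := fun h => by
    have := hT.im_eq_zero_of_mem_spectrum h
    simp [z] at this
    exact hε.ne' this
  obtain ⟨S, hS⟩ := (spectrum.notMem_iff.1 hz)
  -- The unit `S` is `z - T`, hence the sign.
  refine ⟨-(S⁻¹ : (H →L[ℂ] H)ˣ).1 f, ?_⟩
  have h := congrArg (fun S : H →L[ℂ] H => S f) S.mul_inv
  simp only [hS, _root_.mul_apply_eq_comp, _root_.sub_apply, Algebra.algebraMap_eq_smul_one,
    _root_.smul_apply, _root_.one_apply_eq_self] at h
  rw [map_neg, smul_neg]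
  exact Eq.trans (by abel) h

/-- A compactly supported function equal to one on `[x - ε, x + ε]`, dominated by a multiple of
the Poisson kernel. -/
theorem exists_plateau (x : ℝ) {ε : ℝ} (hε : 0 < ε) :
    ∃ g : CompactlySupportedContinuousMap ℝ ℝ, (∀ y, 0 ≤ g y) ∧
      (∀ y ∈ Metric.closedBall x ε, g y = 1) ∧ ∀ y, g y * ((y - x) ^ 2 + ε ^ 2) ≤ 5 * ε ^ 2 := by
  have hcs : HasCompactSupport fun y : ℝ => min 1 (max 0 (2 - |y - x| / ε)) := by
    refine HasCompactSupport.intro (isCompact_closedBall x (2 * ε)) fun y hy => ?_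
    rw [Metric.mem_closedBall, Real.dist_eq, not_le] at hy
    have : 2 ≤ |y - x| / ε := (le_div_iff₀ hε).2 hy.le
    rw [max_eq_left (by linarith)]
    simp
  refine ⟨⟨⟨fun y => min 1 (max 0 (2 - |y - x| / ε)), by fun_prop⟩, hcs⟩, fun y => ?_, fun y hy => ?_,
    fun y => ?_⟩
  · exact le_min zero_le_one (le_max_left _ _)
  · rw [Metric.mem_closedBall, Real.dist_eq] at hy
    have : |y - x| / ε ≤ 1 := (div_le_one hε).2 hy
    exact min_eq_left (le_max_of_le_right (by linarith))
  · change min 1 (max 0 (2 - |y - x| / ε)) * _ ≤ _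
    rcases le_total (|y - x|) (2 * ε) with h | h
    · have h1 : (y - x) ^ 2 ≤ (2 * ε) ^ 2 := sq_le_sq' (abs_le.1 h).1 (abs_le.1 h).2
      calc _ ≤ 1 * ((y - x) ^ 2 + ε ^ 2) := by gcongr; exact min_le_left _ _
        _ ≤ _ := by linarith
    · have : 2 ≤ |y - x| / ε := (le_div_iff₀ hε).2 h
      rw [max_eq_left (by linarith)]
      simp; positivity

/-- The plateau function times `(y - x)² + ε²` is at most `5ε²`, so the sandwich identity bounds the
mass by `5ε²‖u‖²`. -/
theorem spectralMeasure_closedBall_le {T : H →L[ℂ] H} (hT : IsSelfAdjoint T) (f : H) (x : ℝ)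
    {ε C : ℝ} (hε : 0 < ε)
    (hC : ∀ u, T u - ((x : ℂ) + ε * Complex.I) • u = f → ε * ‖u‖ ^ 2 ≤ C) :
    spectralMeasure T f (Metric.closedBall x ε) ≤ ENNReal.ofReal (5 * C * ε) := by
  obtain ⟨g, hg0, hg1, hg⟩ := exists_plateau x hε
  obtain ⟨u, hu⟩ := exists_resolvent_preimage hT x hε f
  refine (spectralMeasure_le_of_eq_one T f g hg0 (isCompact_closedBall x ε) hg1).trans
    (ENNReal.ofReal_le_ofReal ?_)
  rw [inner_resolvent_sandwich hT x ε (g := fun y => g y) g.continuous hu]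
  refine (re_inner_cfc_mono T u (by have := g.continuous; fun_prop) continuous_const hg).trans ?_
  rw [cfc_const (5 * ε ^ 2) T]
  simp only [Algebra.algebraMap_eq_smul_one, _root_.smul_apply,
    _root_.one_apply_eq_self]
  rw [← Complex.coe_smul, inner_smul_right, inner_self_eq_norm_sq_to_K, Complex.re_ofReal_mul]
  have h : (((‖u‖ : ℂ)) ^ 2).re = ‖u‖ ^ 2 := by rw [← Complex.ofReal_pow, Complex.ofReal_re]
  have h2 := hC u hu
  erw [h]
  nlinarith

/-- If a finite measure on `ℝ` satisfies a linear bound on small closed balls around every point of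
`s`, then it is absolutely continuous on `s`. -/
theorem restrict_absolutelyContinuous_of_closedBall_le (μ : Measure ℝ) [IsFiniteMeasure μ]
    {s : Set ℝ} (hs : MeasurableSet s)
    (h : ∀ x ∈ s, ∃ C : ℝ, ∀ᶠ r in 𝓝[>] 0, μ (Metric.closedBall x r) ≤ ENNReal.ofReal (C * r)) :
    μ.restrict s ≪ volume := by
  intro B hB
  rw [Measure.restrict_apply' hs]
  set t : ℕ → Set ℝ := fun n => {x ∈ B | ∀ᶠ r in 𝓝[>] (0 : ℝ),
    μ (Metric.closedBall x r) ≤ ((n : NNReal) • (volume : Measure ℝ)) (Metric.closedBall x r)}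
  have hsub : B ∩ s ⊆ ⋃ n, t n := by
    rintro x ⟨hxB, hxs⟩
    obtain ⟨C, hC⟩ := h x hxs
    obtain ⟨n, hn⟩ := exists_nat_ge C
    refine Set.mem_iUnion.2 ⟨n, hxB, ?_⟩
    filter_upwards [hC, self_mem_nhdsWithin] with r hr hr0
    refine hr.trans ?_
    rw [Set.mem_Ioi] at hr0
    rw [Measure.smul_apply, Real.volume_closedBall, ENNReal.smul_def, smul_eq_mul,
      ENNReal.coe_natCast, ← ENNReal.ofReal_natCast, ← ENNReal.ofReal_mul (by positivity)]
    refine ENNReal.ofReal_le_ofReal ?_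
    have : C * r ≤ n * r := by gcongr
    nlinarith [(Nat.cast_nonneg n : (0 : ℝ) ≤ n)]
  refine measure_mono_null hsub (measure_iUnion_null fun n => ?_)
  -- By Vitali covering, the ball bounds at the points of `t n` give `μ (t n) ≤ n · volume (t n)`,
  -- which is zero as `t n ⊆ B`.
  refine le_antisymm (((Besicovitch.vitaliFamily μ).measure_le_of_frequently_le
    ((n : NNReal) • volume) Measure.AbsolutelyContinuous.rfl (t n) fun x hx => ?_).trans ?_) zero_le
  · exact (Besicovitch.tendsto_filterAt μ x).frequently hx.2.frequently
  · rw [Measure.smul_apply, measure_mono_null (fun x hx => hx.1) hB, smul_zero]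

end SpectralBounds

/-! ### Energy estimates for solutions of the recurrence. -/

section JacobiRecurrence

/-- `u` solves the Jacobi eigenvalue equation at `x + iε` at all sites after `k`. -/
def IsJacobiSolutionAfter (a b : ℕ → ℝ) (x ε : ℝ) (k : ℕ) (u : ℕ → ℂ) : Prop :=
  ∀ n, k ≤ n → (a n : ℂ) * u n + (b (n + 1) : ℂ) * u (n + 1) + (a (n + 1) : ℂ) * u (n + 2)
    = ((x : ℂ) + ε * Complex.I) * u (n + 1)

/-- The size of the Cauchy data of `u` at site `n`. -/
def cauchyNormSq (u : ℕ → ℂ) (n : ℕ) : ℝ := Complex.normSq (u n) + Complex.normSq (u (n + 1))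

theorem cauchyNormSq_nonneg (u : ℕ → ℂ) (n : ℕ) : 0 ≤ cauchyNormSq u n :=
  add_nonneg (Complex.normSq_nonneg _) (Complex.normSq_nonneg _)

/-- A quadratic form in the Cauchy data, conserved along real solutions of the eigenvalue equation
with constant coefficients. -/
def jacobiEnergy (a b : ℕ → ℝ) (x : ℝ) (u : ℕ → ℂ) (n : ℕ) : ℝ :=
  a n ^ 2 * cauchyNormSq u n
    - (x - b n) * a n * ((u n).re * (u (n + 1)).re + (u n).im * (u (n + 1)).im)

theorem abs_dot_le_cauchyNormSq (u : ℕ → ℂ) (n : ℕ) :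
    |(u n).re * (u (n + 1)).re + (u n).im * (u (n + 1)).im| ≤ cauchyNormSq u n / 2 := by
  rw [cauchyNormSq, Complex.normSq_apply, Complex.normSq_apply, abs_le]
  constructor
  · nlinarith [sq_nonneg ((u n).re + (u (n + 1)).re), sq_nonneg ((u n).im + (u (n + 1)).im)]
  · nlinarith [sq_nonneg ((u n).re - (u (n + 1)).re), sq_nonneg ((u n).im - (u (n + 1)).im)]

theorem abs_cross_le_cauchyNormSq (u : ℕ → ℂ) (n : ℕ) :
    |(u (n + 1)).im * (u n).re - (u (n + 1)).re * (u n).im| ≤ cauchyNormSq u n / 2 := by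
  rw [cauchyNormSq, Complex.normSq_apply, Complex.normSq_apply, abs_le]
  constructor
  · nlinarith [sq_nonneg ((u (n + 1)).im + (u n).re), sq_nonneg ((u (n + 1)).re - (u n).im)]
  · nlinarith [sq_nonneg ((u (n + 1)).im - (u n).re), sq_nonneg ((u (n + 1)).re + (u n).im)]

theorem abs_energy_cross_term_le {a b : ℕ → ℝ} {n : ℕ} (ha : 0 < a n) (x : ℝ) (u : ℕ → ℂ) :
    |(x - b n) * a n * ((u n).re * (u (n + 1)).re + (u n).im * (u (n + 1)).im)|
      ≤ |x - b n| * a n / 2 * cauchyNormSq u n := by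
  rw [abs_mul, abs_mul, abs_of_pos ha]
  calc _ ≤ |x - b n| * a n * (cauchyNormSq u n / 2) := by
        gcongr; exact abs_dot_le_cauchyNormSq u n
    _ = _ := by ring

theorem le_jacobiEnergy {a b : ℕ → ℝ} {x c : ℝ} {n : ℕ} (ha : 0 < a n)
    (hc : c ≤ a n ^ 2 - |x - b n| * a n / 2) (u : ℕ → ℂ) :
    c * cauchyNormSq u n ≤ jacobiEnergy a b x u n := by
  have h1 := (abs_le.1 (abs_energy_cross_term_le (b := b) ha x u)).2
  have h2 := mul_le_mul_of_nonneg_right hc (cauchyNormSq_nonneg u n)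
  rw [jacobiEnergy]
  linarith

theorem jacobiEnergy_le {a b : ℕ → ℝ} {x : ℝ} {n : ℕ} (ha : 0 < a n) (ha1 : a n ≤ 1)
    (hb : |x - b n| ≤ 2) (u : ℕ → ℂ) :
    jacobiEnergy a b x u n ≤ 2 * cauchyNormSq u n := by
  have h1 := (abs_le.1 (abs_energy_cross_term_le (b := b) ha x u)).1
  have h2 : a n ^ 2 + |x - b n| * a n / 2 ≤ 2 := by
    nlinarith [mul_le_mul hb ha1 ha.le zero_le_two]
  have h3 := mul_le_mul_of_nonneg_right h2 (cauchyNormSq_nonneg u n)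
  rw [jacobiEnergy]
  linarith

/-- The energy at `n + 1` involves `u (n + 2)` only through `a (n + 1) * u (n + 2)`, apart from the
coefficients at `n + 1`, so the recurrence eliminates it without division. -/
theorem IsJacobiSolutionAfter.energy_succ_sub {a b : ℕ → ℝ} {x ε : ℝ} {k n : ℕ} {u : ℕ → ℂ}
    (hu : IsJacobiSolutionAfter a b x ε k u) (hn : k ≤ n) :
    jacobiEnergy a b x u (n + 1) - jacobiEnergy a b x u n
      = (a (n + 1) ^ 2 - a n ^ 2) * Complex.normSq (u (n + 1))
        + (b (n + 1) - b n) * a n * ((u n).re * (u (n + 1)).re + (u n).im * (u (n + 1)).im)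
        + ε ^ 2 * Complex.normSq (u (n + 1))
        + 2 * ε * a n * ((u (n + 1)).im * (u n).re - (u (n + 1)).re * (u n).im) := by
  have h := hu n hn
  have hre := congrArg Complex.re h
  have him := congrArg Complex.im h
  simp only [Complex.add_re, Complex.add_im, Complex.mul_re, Complex.mul_im, Complex.ofReal_re,
    Complex.ofReal_im, Complex.I_re, Complex.I_im] at hre him
  have hre' : a (n + 1) * (u (n + 2)).re = (x - b (n + 1)) * (u (n + 1)).re
      - ε * (u (n + 1)).im - a n * (u n).re := by linarith
  have him' : a (n + 1) * (u (n + 2)).im = (x - b (n + 1)) * (u (n + 1)).im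
      + ε * (u (n + 1)).re - a n * (u n).im := by linarith
  have e : jacobiEnergy a b x u (n + 1) = a (n + 1) ^ 2 * Complex.normSq (u (n + 1))
      + ((a (n + 1) * (u (n + 2)).re) ^ 2 + (a (n + 1) * (u (n + 2)).im) ^ 2)
      - (x - b (n + 1)) * ((u (n + 1)).re * (a (n + 1) * (u (n + 2)).re)
        + (u (n + 1)).im * (a (n + 1) * (u (n + 2)).im)) := by
    simp only [jacobiEnergy, cauchyNormSq, Complex.normSq_apply]
    ring
  rw [e, hre', him']
  simp only [jacobiEnergy, cauchyNormSq, Complex.normSq_apply]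
  ring

theorem IsJacobiSolutionAfter.energy_sub_le {a b : ℕ → ℝ} {x ε : ℝ} {k n : ℕ} {u : ℕ → ℂ}
    (hu : IsJacobiSolutionAfter a b x ε k u) (hn : k ≤ n) (hε : 0 ≤ ε) (ha : 0 < a n)
    (ha' : 0 < a (n + 1)) (ha1 : a n ≤ 1) (ha1' : a (n + 1) ≤ 1) :
    jacobiEnergy a b x u n - 2 * (|a (n + 1) - a n| + |b (n + 1) - b n| + ε) * cauchyNormSq u n
      ≤ jacobiEnergy a b x u (n + 1) := by
  have hS := cauchyNormSq_nonneg u n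
  have hq : Complex.normSq (u (n + 1)) ≤ cauchyNormSq u n :=
    le_add_of_nonneg_left (Complex.normSq_nonneg _)
  have hq0 := Complex.normSq_nonneg (u (n + 1))
  have h1 : -(2 * |a (n + 1) - a n| * cauchyNormSq u n)
      ≤ (a (n + 1) ^ 2 - a n ^ 2) * Complex.normSq (u (n + 1)) := by
    refine (abs_le.1 ?_).1
    rw [sq_sub_sq, abs_mul, abs_mul, abs_of_nonneg hq0, abs_of_pos (add_pos ha' ha)]
    gcongr
    linarith
  have h2 : -(|b (n + 1) - b n| * cauchyNormSq u n)
      ≤ (b (n + 1) - b n) * a n * ((u n).re * (u (n + 1)).re + (u n).im * (u (n + 1)).im) := by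
    refine (abs_le.1 ?_).1
    rw [abs_mul, abs_mul, abs_of_pos ha, mul_assoc]
    gcongr
    calc _ ≤ 1 * (cauchyNormSq u n / 2) := by gcongr; exact abs_dot_le_cauchyNormSq u n
      _ ≤ _ := by linarith
  have h3 : -(2 * ε * cauchyNormSq u n)
      ≤ 2 * ε * a n * ((u (n + 1)).im * (u n).re - (u (n + 1)).re * (u n).im) := by
    refine (abs_le.1 ?_).1
    rw [abs_mul, abs_mul, abs_of_pos ha, abs_of_nonneg (by positivity : 0 ≤ 2 * ε), mul_assoc]
    gcongr
    calc _ ≤ 1 * (cauchyNormSq u n / 2) := by gcongr; exact abs_cross_le_cauchyNormSq u n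
      _ ≤ _ := by linarith
  -- Only a lower bound is wanted, so the `ε²` term can be dropped.
  have h4 : 0 ≤ ε ^ 2 * Complex.normSq (u (n + 1)) := by positivity
  have h5 : 0 ≤ |b (n + 1) - b n| * cauchyNormSq u n := by positivity
  have := hu.energy_succ_sub hn
  linarith

/-- A nonnegative sequence whose relative decrements sum to at most `1 / 2` loses at most half of
its initial value. -/
theorem half_le_of_sum_decrement_le {E η : ℕ → ℝ} (hη : ∀ n, 0 ≤ η n) (hE0 : 0 ≤ E 0)
    (hE : ∀ n, (1 - η n) * E n ≤ E (n + 1)) {m : ℕ} (hm : ∑ j ∈ Finset.range m, η j ≤ 1 / 2) :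
    E 0 / 2 ≤ E m := by
  -- The inequality `∏ (1 - η_j) ≥ 1 - ∑ η_j`; the bound on the sum keeps every factor nonnegative.
  have key : ∀ n ≤ m, (1 - ∑ j ∈ Finset.range n, η j) * E 0 ≤ E n := by
    intro n
    induction n with
    | zero => simp
    | succ n ih =>
      intro hn
      have hs : ∑ j ∈ Finset.range (n + 1), η j ≤ 1 / 2 :=
        (Finset.sum_le_sum_of_subset_of_nonneg (Finset.range_mono hn)
          fun j _ _ => hη j).trans hm
      rw [Finset.sum_range_succ] at hs ⊢
      have hp : 0 ≤ ∑ j ∈ Finset.range n, η j := Finset.sum_nonneg fun j _ => hη j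
      have h1 := mul_le_mul_of_nonneg_left (ih (by omega)) (by linarith : 0 ≤ 1 - η n)
      have h2 : 0 ≤ η n * (∑ j ∈ Finset.range n, η j) * E 0 := by
        have := hη n
        positivity
      linarith [hE n]
  have := key m le_rfl
  nlinarith

/-- Bridges the finitely many sites before the energy becomes coercive: the recurrence is solved
backwards, at a cost uniform in `ε ∈ [0, 1]`. -/
theorem exists_cauchyNormSq_backward_le {a b : ℕ → ℝ} (ha : ∀ n, 0 < a n) (x : ℝ) (k N : ℕ)
    (hN : k ≤ N) : ∃ M > 0, ∀ ε, 0 ≤ ε → ε ≤ 1 → ∀ u, IsJacobiSolutionAfter a b x ε k u →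
      cauchyNormSq u k ≤ M * cauchyNormSq u N := by
  induction N, hN using Nat.le_induction with
  | base => exact ⟨1, one_pos, fun ε _ _ u _ => (one_mul _).ge⟩
  | succ N hN ih =>
    obtain ⟨M, hM, h⟩ := ih
    set A := |x| + 1 + |b (N + 1)|
    set B := a (N + 1)
    refine ⟨M * (2 * (A ^ 2 + B ^ 2) / a N ^ 2 + 1), by positivity, fun ε hε hε1 u hu =>
      (h ε hε hε1 u hu).trans ?_⟩
    rw [mul_assoc]
    gcongr
    have hp := hu N hN
    have e : (a N : ℂ) * u N = ((x : ℂ) + ε * Complex.I - b (N + 1)) * u (N + 1)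
        - (a (N + 1) : ℂ) * u (N + 2) := by linear_combination hp
    have hz : ‖(x : ℂ) + ε * Complex.I - b (N + 1)‖ ≤ A := by
      refine (norm_sub_le _ _).trans (add_le_add ((norm_add_le _ _).trans ?_) ?_)
      · rw [norm_mul, Complex.norm_I, mul_one, Complex.norm_real, Complex.norm_real,
          Real.norm_eq_abs, Real.norm_eq_abs, abs_of_nonneg hε]
        gcongr
      · rw [Complex.norm_real, Real.norm_eq_abs]
    have hn : a N * ‖u N‖ ≤ A * ‖u (N + 1)‖ + B * ‖u (N + 2)‖ := by
      have h1 := congrArg norm e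
      rw [norm_mul, Complex.norm_real, Real.norm_eq_abs, abs_of_pos (ha N)] at h1
      rw [h1]
      refine (norm_sub_le _ _).trans ?_
      rw [norm_mul, norm_mul, Complex.norm_real, Real.norm_eq_abs, abs_of_pos (ha (N + 1))]
      gcongr
    have hsq : (a N * ‖u N‖) ^ 2 ≤ 2 * (A ^ 2 + B ^ 2) * (‖u (N + 1)‖ ^ 2 + ‖u (N + 2)‖ ^ 2) := by
      have h0 : 0 ≤ a N * ‖u N‖ := mul_nonneg (ha N).le (norm_nonneg _)
      have h1 := pow_le_pow_left₀ h0 hn 2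
      nlinarith [sq_nonneg (A * ‖u (N + 1)‖ - B * ‖u (N + 2)‖), sq_nonneg (A * ‖u (N + 2)‖),
        sq_nonneg (B * ‖u (N + 1)‖)]
    have hdiv : ‖u N‖ ^ 2 ≤ 2 * (A ^ 2 + B ^ 2) / a N ^ 2 * (‖u (N + 1)‖ ^ 2 + ‖u (N + 2)‖ ^ 2) := by
      have := ha N
      rw [div_mul_eq_mul_div, le_div_iff₀ (by positivity)]
      linarith [mul_pow (a N) ‖u N‖ 2]
    simp only [cauchyNormSq, Complex.normSq_eq_norm_sq]
    nlinarith [sq_nonneg ‖u (N + 2)‖]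

theorem eventually_energy_coercive {a b : ℕ → ℝ} (ha : Tendsto a atTop (𝓝 (1 / 2)))
    (hb : Tendsto b atTop (𝓝 0)) {x : ℝ} (hx : x ∈ Set.Ioo (-1 : ℝ) 1) :
    ∃ c > 0, ∀ᶠ n in atTop, a n ≤ 1 ∧ c ≤ a n ^ 2 - |x - b n| * a n / 2 ∧ |x - b n| ≤ 2 := by
  have hx1 : |x| < 1 := abs_lt.2 hx
  have hxb : Tendsto (fun n => |x - b n|) atTop (𝓝 |x|) := by
    simpa using (tendsto_const_nhds.sub hb).abs
  have hlim : Tendsto (fun n => a n ^ 2 - |x - b n| * a n / 2) atTop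
      (𝓝 ((1 / 2) ^ 2 - |x| * (1 / 2) / 2)) := (ha.pow 2).sub ((hxb.mul ha).div_const 2)
  -- Half of the limit `(1 - |x|) / 4` of the coercivity constant.
  refine ⟨(1 - |x|) / 8, by linarith, ?_⟩
  filter_upwards [ha.eventually_le_const (by norm_num : (1 / 2 : ℝ) < 1),
    hlim.eventually_const_le (by linarith : (1 - |x|) / 8 < (1 / 2) ^ 2 - |x| * (1 / 2) / 2),
    hxb.eventually_le_const (by linarith : |x| < 2)] with n h1 h2 h3 using ⟨h1, h2, h3⟩

/-- Solutions of the eigenvalue equation at `x + iε` stay bounded below on a stretch of sites of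
length comparable to `1 / ε`. -/
theorem exists_cauchyNormSq_lower_bound {a b : ℕ → ℝ} (ha_pos : ∀ n, 0 < a n)
    (ha : Tendsto a atTop (𝓝 (1 / 2))) (hb : Tendsto b atTop (𝓝 0))
    (hvar : Summable fun n => |a (n + 1) - a n| + |b (n + 1) - b n|)
    {x : ℝ} (hx : x ∈ Set.Ioo (-1 : ℝ) 1) (k : ℕ) :
    ∃ N : ℕ, ∃ K > 0, ∃ D > 0, ∀ ε, 0 ≤ ε → ε ≤ 1 → ∀ u, IsJacobiSolutionAfter a b x ε k u →
      ∀ m : ℕ, K * ε * m ≤ 1 → cauchyNormSq u k ≤ D * cauchyNormSq u (N + m) := by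
  obtain ⟨c, hc, hev⟩ := eventually_energy_coercive ha hb hx
  have htail := (tendsto_sum_nat_add fun n => |a (n + 1) - a n| + |b (n + 1) - b n|)
  obtain ⟨N, hNk, hN, hNs⟩ := ((eventually_ge_atTop k).and ((eventually_forall_ge_atTop.2 hev).and
    (htail.eventually_le_const (by positivity : 0 < c / 8)))).exists
  obtain ⟨M, hM, hback⟩ := exists_cauchyNormSq_backward_le (b := b) ha_pos x k N hNk
  -- The variation beyond `N` and the total `mε` are each at most `c / 8`, so each takes `1 / 4` of
  -- the allowed decrement `1 / 2`. In `4 * M / c`, one 2 is the halved energy, the other the upper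
  -- energy bound.
  refine ⟨N, 8 / c, by positivity, 4 * M / c, by positivity, fun ε hε hε1 u hu m hm => ?_⟩
  set δ : ℕ → ℝ := fun n => |a (n + 1) - a n| + |b (n + 1) - b n|
  have hδ : ∀ n, 0 ≤ δ n := fun n => by positivity
  set E : ℕ → ℝ := fun n => jacobiEnergy a b x u (N + n)
  have hEl : ∀ n, c * cauchyNormSq u (N + n) ≤ E n := fun n =>
    le_jacobiEnergy (ha_pos _) (hN _ (by omega)).2.1 u
  have hstep : ∀ n, (1 - 2 / c * (δ (n + N) + ε)) * E n ≤ E (n + 1) := fun n => by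
    have h := hu.energy_sub_le (n := N + n) (by omega) hε (ha_pos _) (ha_pos _)
      (hN _ (by omega)).1 (hN (N + n + 1) (by omega)).1
    refine le_trans ?_ h
    have h1 : 2 * (δ (N + n) + ε) * cauchyNormSq u (N + n) ≤ 2 / c * (δ (N + n) + ε) * E n := by
      calc _ = 2 / c * (δ (N + n) + ε) * (c * cauchyNormSq u (N + n)) := by field_simp
        _ ≤ _ := by
          have := hδ (N + n)
          gcongr
          exact hEl n
    rw [add_comm n N]
    linarith
  have hsum : ∑ j ∈ Finset.range m, 2 / c * (δ (j + N) + ε) ≤ 1 / 2 := by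
    rw [← Finset.mul_sum, Finset.sum_add_distrib, Finset.sum_const, Finset.card_range,
      nsmul_eq_mul]
    have h1 : ∑ j ∈ Finset.range m, δ (j + N) ≤ c / 8 :=
      (((summable_nat_add_iff N).2 hvar).sum_le_tsum _ fun j _ => hδ _).trans hNs
    have h2 : m * ε ≤ c / 8 := by
      rw [le_div_iff₀ (by norm_num)]
      rw [div_mul_eq_mul_div, div_mul_eq_mul_div, div_le_one hc] at hm
      linarith
    calc _ ≤ 2 / c * (c / 8 + c / 8) := by gcongr
      _ = 1 / 2 := by field_simp; norm_num
  have hE0 : 0 ≤ E 0 := (mul_nonneg hc.le (cauchyNormSq_nonneg u _)).trans (hEl 0)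
  have hhalf := half_le_of_sum_decrement_le
    (fun n => mul_nonneg (by positivity) (add_nonneg (hδ (n + N)) hε)) hE0 hstep hsum
  have hEu : E m ≤ 2 * cauchyNormSq u (N + m) :=
    jacobiEnergy_le (ha_pos _) (hN _ (by omega)).1 (hN _ (by omega)).2.2 u
  have h0 : c * cauchyNormSq u N ≤ 4 * cauchyNormSq u (N + m) := by
    have := hEl 0
    rw [add_zero] at this
    linarith
  calc _ ≤ M * cauchyNormSq u N := hback ε hε hε1 u hu
    _ = M / c * (c * cauchyNormSq u N) := by field_simp
    _ ≤ M / c * (4 * cauchyNormSq u (N + m)) := by gcongr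
    _ = _ := by ring

theorem sum_cauchyNormSq_le (u : EllTwo) (N m : ℕ) :
    ∑ n ∈ Finset.range m, cauchyNormSq u (N + n) ≤ 2 * ‖u‖ ^ 2 := by
  have hs : Summable fun n => ‖u n‖ ^ 2 := (memlp_two_iff _).1 (lp.memℓp u)
  have ht : ∑' n, ‖u n‖ ^ 2 = ‖u‖ ^ 2 := by
    have := lp.norm_rpow_eq_tsum (p := 2) (by simp) u
    simpa using this.symm
  have key : ∀ M, ∑ n ∈ Finset.range m, ‖u (n + M)‖ ^ 2 ≤ ‖u‖ ^ 2 := fun M => by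
    rw [← ht]
    refine (((summable_nat_add_iff M).2 hs).sum_le_tsum _ fun _ _ => by positivity).trans ?_
    rw [← hs.sum_add_tsum_nat_add M]
    exact le_add_of_nonneg_left (Finset.sum_nonneg fun _ _ => by positivity)
  have h1 := key N
  have h2 := key (N + 1)
  simp only [cauchyNormSq, Complex.normSq_eq_norm_sq, Finset.sum_add_distrib]
  simp only [add_comm N, add_assoc] at h1 h2 ⊢
  simp only [add_comm 1] at *
  linarith

end JacobiRecurrence

/-! ### Resolvent bounds at the basis vectors, and the conclusion. -/

section JacobiSpectrum

variable {a b : ℕ → ℝ} (ha : BddAbove (Set.range fun n => |a n|))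
  (hb : BddAbove (Set.range fun n => |b n|))

theorem isJacobiSolutionAfter_of_resolvent_eq {x ε : ℝ} {k : ℕ} {u : EllTwo}
    (hu : jacobiOperator a b ha hb u - ((x : ℂ) + ε * Complex.I) • u
      = lp.single 2 k (1 : ℂ)) : IsJacobiSolutionAfter a b x ε k u := by
  intro n hn
  have h := congrArg (fun w : EllTwo => w (n + 1)) hu
  simp only [lp.coeFn_sub, Pi.sub_apply, jacobiOperator_apply, jacobiAction_succ, lp.coeFn_smul,
    Pi.smul_apply, smul_eq_mul, lp.single_apply_ne (E := fun _ : ℕ => ℂ) 2 k 1 (by omega : n + 1 ≠ k)] at h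
  linear_combination h

/-- Pair the equation with `u` and take imaginary parts; `⟪u, J u⟫` is real. -/
theorem mul_norm_sq_eq_im_of_resolvent_eq {x ε : ℝ} {k : ℕ} {u : EllTwo}
    (hu : jacobiOperator a b ha hb u - ((x : ℂ) + ε * Complex.I) • u
      = lp.single 2 k (1 : ℂ)) : ε * ‖u‖ ^ 2 = (u k).im := by
  have hsym : (⟪u, jacobiOperator a b ha hb u⟫_ℂ).im = 0 := by
    have h := isSymmetric_jacobiLinearMap a b ha hb u u
    rw [← inner_conj_symm] at h
    exact Complex.conj_eq_iff_im.1 h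
  have h := congrArg (fun w : EllTwo => (⟪u, w⟫_ℂ).im) hu
  simp only [inner_sub_right, inner_smul_right, Complex.sub_im, hsym, lp.inner_single_right,
    inner_self_eq_norm_sq_to_K] at h
  simp [← Complex.ofReal_pow] at h
  simpa using h

theorem exists_resolvent_bound (ha_pos : ∀ n, 0 < a n) (ha' : Tendsto a atTop (𝓝 (1 / 2)))
    (hb' : Tendsto b atTop (𝓝 0))
    (hvar : Summable fun n => |a (n + 1) - a n| + |b (n + 1) - b n|)
    {x : ℝ} (hx : x ∈ Set.Ioo (-1 : ℝ) 1) (k : ℕ) :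
    ∃ C : ℝ, ∀ᶠ ε : ℝ in 𝓝[>] 0, ∀ u : EllTwo,
      jacobiOperator a b ha hb u - ((x : ℂ) + ε * Complex.I) • u = lp.single 2 k (1 : ℂ) →
        ε * ‖u‖ ^ 2 ≤ C := by
  obtain ⟨N, K, hK, D, hD, h⟩ := exists_cauchyNormSq_lower_bound ha_pos ha' hb' hvar hx k
  refine ⟨4 * K * D, ?_⟩
  -- `Kε ≤ 1/2` ensures that rounding `1 / (Kε)` down to `m` still leaves `Kεm ≥ 1/2`.
  filter_upwards [Ioc_mem_nhdsGT (by positivity : 0 < min 1 (1 / (2 * K)))] with ε hε u hu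
  obtain ⟨hε0, hε1⟩ := hε
  have hε2 : ε ≤ 1 / (2 * K) := hε1.trans (min_le_right _ _)
  rw [le_div_iff₀ (by positivity)] at hε2
  have hrec := isJacobiSolutionAfter_of_resolvent_eq ha hb hu
  have him := mul_norm_sq_eq_im_of_resolvent_eq ha hb hu
  have hKε : 0 < K * ε := by positivity
  set m := ⌊1 / (K * ε)⌋₊
  have hm1 : K * ε * m ≤ 1 := by
    have := Nat.floor_le (by positivity : 0 ≤ 1 / (K * ε))
    rw [le_div_iff₀ hKε] at this
    linarith
  have hm2 : 1 ≤ 2 * (K * ε * m) := by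
    have := Nat.lt_floor_add_one (1 / (K * ε))
    rw [div_lt_iff₀ hKε] at this
    change 1 < ((m : ℝ) + 1) * (K * ε) at this
    linarith
  have hsum : m * cauchyNormSq u k ≤ D * (2 * ‖u‖ ^ 2) := by
    calc m * cauchyNormSq u k = ∑ n ∈ Finset.range m, cauchyNormSq u k := by simp
      _ ≤ ∑ n ∈ Finset.range m, D * cauchyNormSq u (N + n) := by
          refine Finset.sum_le_sum fun n hn => h ε hε0.le (hε1.trans (min_le_left _ _)) u hrec n ?_
          refine le_trans ?_ hm1
          have : n ≤ m := (Finset.mem_range.1 hn).le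
          gcongr
      _ ≤ _ := by
          rw [← Finset.mul_sum]
          gcongr
          exact sum_cauchyNormSq_le u N m
  have hk : ‖u k‖ ^ 2 ≤ cauchyNormSq u k := by
    rw [cauchyNormSq, Complex.normSq_eq_norm_sq]
    exact le_add_of_nonneg_right (Complex.normSq_nonneg _)
  have hle : ε * ‖u‖ ^ 2 ≤ ‖u k‖ := him.le.trans ((le_abs_self _).trans (Complex.abs_im_le_norm _))
  -- The estimate closes on itself: quadratic in `‖u k‖` on the left, linear on the right.
  have hfin : ‖u k‖ ^ 2 ≤ 4 * K * D * ‖u k‖ := by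
    calc ‖u k‖ ^ 2 ≤ 2 * (K * ε * m) * cauchyNormSq u k := by
          nlinarith [cauchyNormSq_nonneg u k]
      _ = 2 * (K * ε) * (m * cauchyNormSq u k) := by ring
      _ ≤ 2 * (K * ε) * (D * (2 * ‖u‖ ^ 2)) := by gcongr
      _ = 4 * K * D * (ε * ‖u‖ ^ 2) := by ring
      _ ≤ _ := by gcongr
  refine hle.trans ?_
  rcases (norm_nonneg (u k)).eq_or_lt with h0 | h0
  · rw [← h0]; positivity
  · nlinarith

end JacobiSpectrum

theorem corollary5p4 (a b : ℕ → ℝ) (ha_pos : ∀ n, 0 < a n)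
    (ha : Tendsto a atTop (𝓝 (1 / 2))) (hb : Tendsto b atTop (𝓝 0))
    (hvar : Summable fun n => |a (n + 1) - a n| + |b (n + 1) - b n|) :
    HasAbsolutelyContinuousSpectrumOn
      (jacobiOperator a b ha.abs.bddAbove_range hb.abs.bddAbove_range) (Set.Ioo (-1) 1) := by
  intro f B hB
  have hT := isSelfAdjoint_jacobiOperator a b ha.abs.bddAbove_range hb.abs.bddAbove_range
  set T := jacobiOperator a b ha.abs.bddAbove_range hb.abs.bddAbove_range
  rw [Measure.restrict_apply' measurableSet_Ioo]
  set V := spectralNullSubmodule hT (B ∩ Set.Ioo (-1) 1)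
  have hsingle : ∀ k, lp.single 2 k (1 : ℂ) ∈ V := fun k => by
    have hfin := isFiniteMeasure_spectralMeasure hT (lp.single 2 k (1 : ℂ))
    have hac := restrict_absolutelyContinuous_of_closedBall_le
      (spectralMeasure T (lp.single 2 k (1 : ℂ))) (measurableSet_Ioo (a := (-1 : ℝ)) (b := 1))
      fun x hx => by
        obtain ⟨C, hC⟩ := exists_resolvent_bound ha.abs.bddAbove_range hb.abs.bddAbove_range
          ha_pos ha hb hvar hx k
        refine ⟨5 * C, ?_⟩
        filter_upwards [hC, self_mem_nhdsWithin] with ε hε hε0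
        exact spectralMeasure_closedBall_le hT _ x hε0 hε
    have := hac hB
    rwa [Measure.restrict_apply' measurableSet_Ioo] at this
  -- `f` is the limit of its finitely supported truncations.
  refine (isClosed_spectralNullSubmodule hT _).mem_of_tendsto
    (lp.hasSum_single ENNReal.ofNat_ne_top f) (Eventually.of_forall fun s => ?_)
  refine V.sum_mem fun k _ => ?_
  have e : lp.single 2 k (f k) = f k • (lp.single 2 k (1 : ℂ) : EllTwo) := by
    rw [← lp.single_smul, smul_eq_mul, mul_one]
  rw [e]
  exact V.smul_mem _ (hsingle k)
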